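/- A finite set $P\subset\mathbb{R}^d$ is in general position if no $d+1$ of its points lie in a common hyperplane. A $k$-simplex spanned by $P$ is the convex hull of $k+1$ points of $P$. A Tverberg partition of a set $Q\subset\mathbb{R}^d$ of $(r-1)(d+1)+1$ points into $r$ sets is a partition $Q=D_1\cup\dots\cup D_r$ into nonempty, pairwise disjoint sets with $\bigcap_{i=1}^r \operatorname{conv}(D_i)\neq\emptyset$; the Tverberg point it determines is the lexicographic minimum of $\bigcap_{i=1}^r \operatorname{conv}(D_i)$. **Theorem (Simplex Containing Many Points Lemma).** (1) For every $d\ge 1$ there is a constant $c=c(d)>0$ such that the following holds. Let $P\subset\mathbb{R}^d$ be a set of $n\ge d^2+d+1$ points in general position. Then there exist a $d$-simplex $\Delta$ spanned by $P$ and at least $c\binom{n}{d^2}$ different $d^2$-element subsets $Q$ of $P$, each of which has a Tverberg partition into $d$ sets that determines a Tverberg point lying in $\Delta$. (2) There are a constant $c>0$ and an integer $n_0$ such that for every set $P\subset\mathbb{R}^2$ of $n\ge n_0$ points in general position there is a triangle $\Delta$ spanned by $P$ such that at least $cn^4$ unordered pairs of segments spanned by $P$, each pair having four distinct endpoints, cross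 (their relative interiors meet) at a point of $\Delta$. -/

import Mathlib

/-! Points of `ℝ^d` are functions `Fin d → ℝ`; only the affine structure and the order of the
coordinates are used below, never a norm. -/

/-- A finite point set in `ℝ^d` is in general position if no `d + 1` of its points lie in a common
hyperplane `{x | a ⬝ᵥ x = b}`, `a ≠ 0`. -/
def InGeneralPosition {d : ℕ} (P : Finset (Fin d → ℝ)) : Prop :=
  ∀ S ⊆ P, S.card = d + 1 →
    ¬ ∃ (a : Fin d → ℝ) (b : ℝ), a ≠ 0 ∧ ∀ p ∈ S, dotProduct a p = b

/-- `Δ` is a `k`-dimensional simplex spanned by `P`: the convex hull of `k + 1` points of `P`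
(for `P` in general position and `k ≤ d` these are affinely independent). -/
def IsSpannedSimplex {d : ℕ} (P : Finset (Fin d → ℝ)) (k : ℕ) (Δ : Set (Fin d → ℝ)) : Prop :=
  ∃ S ⊆ P, S.card = k + 1 ∧ Δ = convexHull ℝ (S : Set (Fin d → ℝ))

/-- `x` is the minimum of `K` in the lexicographic order of `ℝ^d`. -/
def IsLexMin {d : ℕ} (K : Set (Fin d → ℝ)) (x : Fin d → ℝ) : Prop :=
  x ∈ K ∧ ∀ y ∈ K, toLex x ≤ toLex y

/-- `D 0, …, D (r - 1)` is a partition of the finite set `Q` into `r` nonempty sets. -/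
structure IsPartition {d r : ℕ} (Q : Finset (Fin d → ℝ)) (D : Fin r → Finset (Fin d → ℝ)) :
    Prop where
  nonempty : ∀ i, (D i).Nonempty
  disjoint : ∀ i j, i ≠ j → Disjoint (D i) (D j)
  cover : ∀ p, p ∈ Q ↔ ∃ i, p ∈ D i

/-- The common part of the convex hulls of the sets `D i`. -/
def hullInter {d r : ℕ} (D : Fin r → Finset (Fin d → ℝ)) : Set (Fin d → ℝ) :=
  ⋂ i, convexHull ℝ (D i : Set (Fin d → ℝ))

/-- A Tverberg partition of a set `Q` of `(r - 1) (d + 1) + 1` points of `ℝ^d`: a partition into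
`r` sets whose convex hulls have a common point. -/
structure IsTverbergPartition {d r : ℕ} (Q : Finset (Fin d → ℝ))
    (D : Fin r → Finset (Fin d → ℝ)) : Prop where
  card_eq : Q.card = (r - 1) * (d + 1) + 1
  partition : IsPartition Q D
  inter_nonempty : (hullInter D).Nonempty

/-- `q` is an unordered pair of segments spanned by `P`, with four distinct endpoints, that cross
(their relative interiors meet) at a point of `Δ`. A spanned segment is recorded as the unordered
pair of its endpoints. -/
def IsCrossingPairIn {d : ℕ} (P : Finset (Fin d → ℝ)) (Δ : Set (Fin d → ℝ))
    (q : Sym2 (Sym2 (Fin d → ℝ))) : Prop :=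
  ∃ a ∈ P, ∃ b ∈ P, ∃ u ∈ P, ∃ v ∈ P, [a, b, u, v].Nodup ∧ q = s(s(a, b), s(u, v)) ∧
    (openSegment ℝ a b ∩ openSegment ℝ u v ∩ Δ).Nonempty

/-! Both parts follow from one local statement: every set of some fixed size m contains a simplex S
and a disjoint set Q whose Tverberg (or crossing) point lies in the hull of S. Double counting the
pairs (S, Q) against the m-subsets of P, and taking the S with the most partners, gives a simplex
related to a positive fraction of the sets Q (`exists_popular_subset`).

For part (1), m = d² + d + 1 = d(d + 1) + 1, so Tverberg's theorem, proved by Sarkaria's tensor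
trick from colorful Carathéodory, gives d + 1 disjoint classes whose hulls share a point x. When the
total number of points used is least, no simultaneous affine dependency can be shifted along, so
every class is affinely independent and the directions of the affine spans meet only in 0. One class
is dropped and completed to the vertex set of S. Counting codimensions, the other d classes have at
most d² points. Either fewer than d of the directions already meet trivially, and some class can
absorb the leftover points without creating new common points, or the d remaining classes span
hyperplanes, have d points each, and nothing is left over (`exists_small_subfamily_or_hyperplanes`).
The hulls then meet in x alone, so x is the lexicographic minimum.

For part (2), the case d = 2 may yield a point inside a triangle instead of a crossing; this cannot
happen for seven points in convex position. Among 29 points there are seven disjoint crossing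
quadruples. Either some crossing lies in the hull of the other quadruples, and Carathéodory gives
the triangle, or each quadruple has a point outside that hull, and these seven points are in convex
position. -/

/-! ### Colorful Carathéodory. -/

/-- If `y` has the least norm on the segment `[y, z]`, then `z` lies beyond the hyperplane through
`y` orthogonal to `y`. -/
theorem norm_sq_le_inner_of_forall_segment {E : Type*} [NormedAddCommGroup E]
    [InnerProductSpace ℝ E] {y z : E} (h : ∀ w ∈ segment ℝ y z, ‖y‖ ≤ ‖w‖) :
    ‖y‖ ^ 2 ≤ inner ℝ y z := by
  have hy : y ∈ segment ℝ y z := left_mem_segment ℝ y z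
  have hz : z ∈ segment ℝ y z := right_mem_segment ℝ y z
  have key := (norm_eq_iInf_iff_real_inner_le_zero (convex_segment y z) (u := 0) hy).1 (by
    have : Nonempty (segment ℝ y z) := ⟨⟨y, hy⟩⟩
    apply le_antisymm
    · exact le_ciInf fun w => by simpa using h w w.2
    · exact ciInf_le (f := fun w : segment ℝ y z => ‖(0 : E) - w‖)
        ⟨0, by rintro _ ⟨w, rfl⟩; exact norm_nonneg _⟩ ⟨y, hy⟩) z hz
  rw [zero_sub, inner_neg_left, inner_sub_right, real_inner_self_eq_norm_sq] at key
  linarith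

/-- **Colorful Carathéodory theorem**: if `0` lies in the convex hull of each of more than `dim E`
colour classes, then it lies in the convex hull of a rainbow selection. -/
theorem colorful_caratheodory {ι κ E : Type*} [Fintype ι] [Finite κ] [NormedAddCommGroup E]
    [InnerProductSpace ℝ E] [FiniteDimensional ℝ E] (v : ι → κ → E)
    (hv : ∀ i, (0 : E) ∈ convexHull ℝ (Set.range (v i)))
    (hcard : Module.finrank ℝ E < Fintype.card ι) :
    ∃ j : ι → κ, (0 : E) ∈ convexHull ℝ (Set.range fun i => v i (j i)) := by
  classical
  have hκ : ∀ i : ι, Nonempty κ := fun i => by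
    have : (Set.range (v i)).Nonempty := (convexHull_nonempty_iff (𝕜 := ℝ)).1 ⟨0, hv i⟩
    exact Set.range_nonempty_iff_nonempty.1 this
  obtain ⟨i₀⟩ : Nonempty ι := Fintype.card_pos_iff.1 (by omega)
  have := hκ i₀
  set K : (ι → κ) → Set E := fun j => convexHull ℝ (Set.range fun i => v i (j i)) with hK
  have hcomp : IsCompact (⋃ j, K j) :=
    isCompact_iUnion fun j => (Set.finite_range _).isCompact_convexHull (𝕜 := ℝ)
  have hne : (⋃ j, K j).Nonempty := by
    obtain ⟨j⟩ : Nonempty (ι → κ) := inferInstance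
    exact ⟨v i₀ (j i₀), Set.mem_iUnion.2 ⟨j, subset_convexHull _ _ ⟨i₀, rfl⟩⟩⟩
  -- Bárány's argument: y is the point of least norm over all rainbow hulls; if y ≠ 0, exchanging
  -- one colour brings a hull closer to 0.
  obtain ⟨y, hyK, hymin⟩ := hcomp.exists_isMinOn hne continuous_norm.continuousOn
  obtain ⟨j, hyj⟩ := Set.mem_iUnion.1 hyK
  by_cases hy0 : y = 0
  · exact ⟨j, hy0 ▸ hyj⟩
  exfalso
  have hpos : 0 < ‖y‖ ^ 2 := by positivity
  have hinner : ∀ j', y ∈ K j' → ∀ z ∈ K j', ‖y‖ ^ 2 ≤ inner ℝ y z := fun j' hy z hz =>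
    norm_sq_le_inner_of_forall_segment fun w hw =>
      hymin (Set.mem_iUnion.2 ⟨j', (convex_convexHull ℝ _).segment_subset hy hz hw⟩)
  obtain ⟨T, _, z, w, hzr, hzi, hwpos, hwsum, hwy⟩ := eq_pos_convex_span_of_mem_convexHull hyj
  have hzK : ∀ t, z t ∈ K j := fun t => subset_convexHull _ _ (hzr ⟨t, rfl⟩)
  have heq : ∀ t, inner ℝ y (z t) = ‖y‖ ^ 2 := by
    have hsum : ∑ t, w t * (inner ℝ y (z t) - ‖y‖ ^ 2) = 0 := by
      have : inner ℝ y (∑ t, w t • z t) = ‖y‖ ^ 2 := by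
        rw [hwy, real_inner_self_eq_norm_sq]
      rw [inner_sum] at this
      simp only [inner_smul_right] at this
      simp only [mul_sub, Finset.sum_sub_distrib, ← Finset.sum_mul, hwsum, this]
      ring
    intro t
    have := (Finset.sum_eq_zero_iff_of_nonneg (fun t _ =>
      mul_nonneg (hwpos t).le (sub_nonneg.2 (hinner j hyj _ (hzK t))))).1 hsum t (Finset.mem_univ t)
    rcases mul_eq_zero.1 this with h | h
    · exact absurd h (hwpos t).ne'
    · linarith
  -- The z t are affinely independent and lie on a hyperplane missing 0, so they are linearly
  -- independent. Hence at most dim E colours carry y and some colour i is free to change.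
  have hlin : LinearIndependent ℝ z := by
    rw [Fintype.linearIndependent_iff]
    intro c hc
    have hc0 : ∑ t, c t = 0 := by
      have : inner ℝ y (∑ t, c t • z t) = 0 := by rw [hc, inner_zero_right]
      rw [inner_sum] at this
      simp only [inner_smul_right, heq, ← Finset.sum_mul] at this
      exact (mul_eq_zero.1 this).resolve_right hpos.ne'
    exact fun t => affineIndependent_iff.1 hzi Finset.univ c hc0 hc t (Finset.mem_univ t)
  have hT : Fintype.card T < Fintype.card ι := hlin.fintype_card_le_finrank.trans_lt hcard
  choose f hf using fun t => hzr ⟨t, rfl⟩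
  obtain ⟨i, hi⟩ : ∃ i, ∀ t, f t ≠ i := by
    by_contra! hcon
    exact absurd (Fintype.card_le_of_surjective f hcon) (not_le.2 hT)
  obtain ⟨k, hk⟩ : ∃ k, inner ℝ y (v i k) ≤ 0 := by
    by_contra! hcon
    have hsub : convexHull ℝ (Set.range (v i)) ⊆ {x | 0 < inner ℝ y x} :=
      convexHull_min (by rintro _ ⟨k, rfl⟩; exact hcon k)
        (convex_halfSpace_gt (innerₛₗ ℝ y).isLinear 0)
    simpa using hsub (hv i)
  have hz' : ∀ t, z t ∈ K (Function.update j i k) := fun t =>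
    subset_convexHull _ _ ⟨f t, by simpa [Function.update_of_ne (hi t)] using hf t⟩
  have hyK' : y ∈ K (Function.update j i k) := by
    rw [← hwy]
    exact (convex_convexHull ℝ _).sum_mem (fun t _ => (hwpos t).le) hwsum fun t _ => hz' t
  have := hinner _ hyK' (v i k) (subset_convexHull _ _ ⟨i, by simp⟩)
  linarith

/-! ### Tverberg's theorem. -/

theorem exists_weights_of_mem_convexHull_range {ι E : Type*} [Fintype ι] [AddCommGroup E]
    [Module ℝ E] {v : ι → E} {x : E} (hx : x ∈ convexHull ℝ (Set.range v)) :
    ∃ w : ι → ℝ, (∀ i, 0 ≤ w i) ∧ ∑ i, w i = 1 ∧ ∑ i, w i • v i = x := by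
  classical
  have hconv : Convex ℝ {x | ∃ w : ι → ℝ, (∀ i, 0 ≤ w i) ∧ ∑ i, w i = 1 ∧ ∑ i, w i • v i = x} := by
    rintro _ ⟨w, hw, hw1, rfl⟩ _ ⟨w', hw', hw1', rfl⟩ a b ha hb hab
    refine ⟨fun i => a * w i + b * w' i,
      fun i => add_nonneg (mul_nonneg ha (hw i)) (mul_nonneg hb (hw' i)), ?_, ?_⟩
    · rw [Finset.sum_add_distrib, ← Finset.mul_sum, ← Finset.mul_sum, hw1, hw1', mul_one, mul_one,
        hab]
    · simp only [add_smul, mul_smul, Finset.sum_add_distrib, ← Finset.smul_sum]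
  refine convexHull_min ?_ hconv hx
  rintro _ ⟨i, rfl⟩
  exact ⟨Pi.single i 1, fun k => by rw [Pi.single_apply]; split_ifs <;> norm_num, by simp,
    by simp [Pi.single_apply, ite_smul]⟩

/-- **Tverberg's theorem**: any `r (d + 1) + 1` points of `ℝ^d` can be divided into `r + 1` classes
whose convex hulls have a common point. -/
theorem exists_tverberg {d r : ℕ} {Q : Finset (Fin d → ℝ)} (hQ : r * (d + 1) < Q.card) :
    ∃ (D : Fin (r + 1) → Finset (Fin d → ℝ)) (x : Fin d → ℝ), (∀ k, D k ⊆ Q) ∧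
      (∀ k l, k ≠ l → Disjoint (D k) (D l)) ∧ ∀ k, x ∈ convexHull ℝ (D k : Set (Fin d → ℝ)) := by
  classical
  -- Sarkaria's trick: the r + 1 vectors e k sum to zero, and v p k is the tensor product of e k
  -- with (1, p). The points p are the colours, so a rainbow selection assigns each point to a
  -- class.
  let e : Fin (r + 1) → Fin r → ℝ := Fin.cons (fun _ => -1) fun k => Pi.single k 1
  let lift : (Fin d → ℝ) → Option (Fin d) → ℝ := fun p l => l.elim 1 p
  let v : Q → Fin (r + 1) → EuclideanSpace ℝ (Fin r × Option (Fin d)) := fun p k =>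
    WithLp.toLp 2 fun al => e k al.1 * lift p al.2
  have he : ∀ a, ∑ k, e k a = 0 := fun a => by
    rw [Fin.sum_univ_succ]
    simp [e, Pi.single_apply]
  have hv : ∀ p, (0 : EuclideanSpace ℝ (Fin r × Option (Fin d))) ∈
      convexHull ℝ (Set.range (v p)) := fun p => by
    refine mem_convexHull_of_exists_fintype (fun _ : Fin (r + 1) => ((r : ℝ) + 1)⁻¹) (v p)
      (fun _ => by positivity) ?_ (fun k => ⟨k, rfl⟩) ?_
    · simp
      field_simp
    · ext al
      simp [v, ← Finset.mul_sum, ← Finset.sum_mul, he]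
  obtain ⟨c, hc⟩ := colorful_caratheodory v hv (by
    simp only [finrank_euclideanSpace, Fintype.card_prod, Fintype.card_fin, Fintype.card_option,
      Fintype.card_coe]
    exact hQ)
  obtain ⟨w, hw0, hw1, hwv⟩ := exists_weights_of_mem_convexHull_range hc
  -- the weighted sums of the lifted points over the classes agree
  have hclass : ∀ k l, ∑ p with c p = k, w p * lift p l = ∑ p with c p = 0, w p * lift p l := by
    intro k l
    refine Fin.cases rfl (fun k => ?_) k
    have h1 : ∑ p, w p * (e (c p) k * lift p l) = 0 := by
      have := congrArg (fun z : EuclideanSpace ℝ (Fin r × Option (Fin d)) => z (k, l)) hwv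
      simpa [v] using this
    have h2 : ∀ p : Q, w p * (e (c p) k * lift p l) =
        (if c p = k.succ then w p * lift p l else 0) - if c p = 0 then w p * lift p l else 0 := by
      intro p
      rcases Fin.eq_zero_or_eq_succ (c p) with h | ⟨m, h⟩
      · simp [h, e, (Fin.succ_ne_zero k).symm]
      · simp [h, e, Pi.single_apply, eq_comm]
    simp only [h2, Finset.sum_sub_distrib, ← Finset.sum_filter] at h1
    linarith
  set W := ∑ p with c p = 0, w p with hW
  have hWk : ∀ k, ∑ p with c p = k, w p = W := fun k => by simpa [lift, hW] using hclass k none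
  have hWpos : 0 < W := by
    have : ∑ k : Fin (r + 1), ∑ p with c p = k, w p = 1 := by
      rw [← hw1, Finset.sum_fiberwise]
    simp only [hWk, Finset.sum_const, Finset.card_univ, Fintype.card_fin, nsmul_eq_mul] at this
    by_contra! hcon
    have : ((r + 1 : ℕ) : ℝ) * W ≤ 0 := mul_nonpos_of_nonneg_of_nonpos (by positivity) hcon
    linarith
  refine ⟨fun k => ({p : Q | c p = k} : Finset Q).map (Function.Embedding.subtype _),
    W⁻¹ • ∑ p with c p = 0, w p • (p : Fin d → ℝ), ?_, ?_, ?_⟩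
  · intro k p hp
    simp only [Finset.mem_map, Finset.mem_filter] at hp
    obtain ⟨q, _, rfl⟩ := hp
    exact q.2
  · intro k l hkl
    rw [Finset.disjoint_map]
    exact Finset.disjoint_filter.2 fun p _ h1 h2 => hkl (h1 ▸ h2)
  · intro k
    have hsum : ∑ p with c p = k, w p • (p : Fin d → ℝ) =
        ∑ p with c p = 0, w p • (p : Fin d → ℝ) := by
      ext l
      simpa [lift] using hclass k (some l)
    rw [← hsum, ← hWk k, ← Finset.centerMass]
    refine Finset.centerMass_mem_convexHull _ (fun p _ => hw0 p) (by rwa [hWk k]) fun p hp => ?_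
    simpa using hp

/-! ### Hull covers with the fewest points. -/

/-- A vector of the direction of a finite set is an affine dependency applied to the set. -/
theorem exists_weights_of_mem_vectorSpan {E : Type*} [AddCommGroup E] [Module ℝ E]
    {s : Finset E} {u : E} (hu : u ∈ vectorSpan ℝ (s : Set E)) :
    ∃ μ : E → ℝ, ∑ p ∈ s, μ p = 0 ∧ ∑ p ∈ s, μ p • p = u := by
  classical
  refine Submodule.span_induction ?_ ⟨0, by simp, by simp⟩ ?_ ?_ hu
  · rintro _ ⟨p, hp, q, hq, rfl⟩
    refine ⟨Pi.single p 1 - Pi.single q 1, ?_, ?_⟩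
    · simp_all [Pi.single_apply]
    · simp_all [Pi.single_apply, sub_smul, ite_smul]
  · rintro _ _ _ _ ⟨μ, h1, rfl⟩ ⟨μ', h1', rfl⟩
    exact ⟨μ + μ', by simp [Finset.sum_add_distrib, h1, h1'],
      by simp [add_smul, Finset.sum_add_distrib]⟩
  · rintro a _ _ ⟨μ, h1, rfl⟩
    exact ⟨a • μ, by simp [← Finset.mul_sum, h1], by simp [mul_smul, Finset.smul_sum]⟩

/-- A tuple of pairwise disjoint subsets of `Q` whose convex hulls all contain `x`. -/
structure HullCover {E κ : Type*} [AddCommGroup E] [Module ℝ E] (Q : Finset E) (D : κ → Finset E)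
    (x : E) : Prop where
  subset : ∀ k, D k ⊆ Q
  disjoint : ∀ k l, k ≠ l → Disjoint (D k) (D l)
  mem : ∀ k, x ∈ convexHull ℝ (D k : Set E)

/-- In a hull cover with the least total number of points, no simultaneous affine dependency moves
the common point. -/
theorem HullCover.weights_eq_zero {E κ : Type*} [AddCommGroup E] [Module ℝ E] [Fintype κ]
    {Q : Finset E} {D : κ → Finset E} {x : E} (h : HullCover Q D x)
    (hmin : ∀ (D' : κ → Finset E) (x' : E), HullCover Q D' x' → ∑ k, (D k).card ≤ ∑ k, (D' k).card)
    {μ : κ → E → ℝ} {u : E} (hμ0 : ∀ k, ∑ p ∈ D k, μ k p = 0)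
    (hμu : ∀ k, ∑ p ∈ D k, μ k p • p = u) : ∀ k, ∀ p ∈ D k, μ k p = 0 := by
  classical
  choose w hw0 hw1 hwx using fun k => Finset.mem_convexHull'.1 (h.mem k)
  by_contra! hcon
  obtain ⟨k₁, p₁, hp₁, hne⟩ := hcon
  obtain ⟨p₂, hp₂, hneg⟩ : ∃ p ∈ D k₁, μ k₁ p < 0 := by
    by_contra! hcon
    exact hne ((Finset.sum_eq_zero_iff_of_nonneg hcon).1 (hμ0 k₁) p₁ hp₁)
  -- The weights move along μ until the first one vanishes, at the least ratio t. The common point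
  -- becomes x + t u and p₀ is no longer needed, against minimality.
  obtain ⟨⟨k₀, p₀⟩, hm, hle⟩ := Finset.exists_min_image
    ((Finset.univ.sigma D).filter fun kp => μ kp.1 kp.2 < 0) (fun kp => w kp.1 kp.2 / -μ kp.1 kp.2)
    ⟨⟨k₁, p₂⟩, by simp [hp₂, hneg]⟩
  simp only [Finset.mem_filter, Finset.mem_sigma, Finset.mem_univ, true_and] at hm hle
  set t := w k₀ p₀ / -μ k₀ p₀ with ht
  have ht0 : 0 ≤ t := div_nonneg (hw0 k₀ p₀ hm.1) (by linarith [hm.2])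
  have hnew0 : ∀ k, ∀ p ∈ D k, 0 ≤ w k p + t * μ k p := by
    intro k p hp
    rcases lt_or_ge (μ k p) 0 with hlt | hge
    · have := hle ⟨k, p⟩ ⟨hp, hlt⟩
      rw [le_div_iff₀ (by simpa using hlt)] at this
      simp only at this
      linarith
    · have := hw0 k p hp
      positivity
  have hnew1 : ∀ k, ∑ p ∈ D k, (w k p + t * μ k p) = 1 := fun k => by
    rw [Finset.sum_add_distrib, ← Finset.mul_sum, hμ0, hw1, mul_zero, add_zero]
  have hnewx : ∀ k, ∑ p ∈ D k, (w k p + t * μ k p) • p = x + t • u := fun k => by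
    simp only [add_smul, mul_smul, Finset.sum_add_distrib, ← Finset.smul_sum, hwx, hμu]
  have hzero : w k₀ p₀ + t * μ k₀ p₀ = 0 := by
    rw [ht]
    field_simp [hm.2.ne]
    ring
  have hcover : HullCover Q (Function.update D k₀ ((D k₀).erase p₀)) (x + t • u) := by
    have hsub : ∀ k, Function.update D k₀ ((D k₀).erase p₀) k ⊆ D k := fun k => by
      rcases eq_or_ne k k₀ with rfl | hk
      · simpa using Finset.erase_subset _ _
      · simp [hk]
    refine ⟨fun k => (hsub k).trans (h.subset k),
      fun k l hkl => (h.disjoint k l hkl).mono (hsub k) (hsub l), fun k => ?_⟩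
    refine Finset.mem_convexHull'.2
      ⟨fun p => w k p + t * μ k p, fun p hp => hnew0 k p (hsub k hp), ?_, ?_⟩
    · beta_reduce
      rcases eq_or_ne k k₀ with rfl | hk
      · rw [Function.update_self, Finset.sum_erase (f := fun p => w k p + t * μ k p) _ hzero, hnew1]
      · rw [Function.update_of_ne hk, hnew1]
    · beta_reduce
      rcases eq_or_ne k k₀ with rfl | hk
      · rw [Function.update_self, Finset.sum_erase (f := fun p => (w k p + t * μ k p) • p) _
          (by rw [hzero, zero_smul]), hnewx]
      · rw [Function.update_of_ne hk, hnewx]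
  have := hmin _ _ hcover
  refine absurd this (not_le.2 (Finset.sum_lt_sum (fun k _ => ?_) ⟨k₀, Finset.mem_univ _, ?_⟩))
  · rcases eq_or_ne k k₀ with rfl | hk
    · rw [Function.update_self]; exact Finset.card_le_card (Finset.erase_subset _ _)
    · rw [Function.update_of_ne hk]
  · rw [Function.update_self]; exact Finset.card_erase_lt_of_mem hm.1

/-- A set of more than `r (d + 1)` points contains `r + 1` disjoint affinely independent sets whose
convex hulls have a common point and whose directions intersect trivially. -/
theorem exists_independent_hullCover {d r : ℕ} {Q : Finset (Fin d → ℝ)}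
    (hQ : r * (d + 1) < Q.card) :
    ∃ (D : Fin (r + 1) → Finset (Fin d → ℝ)) (x : Fin d → ℝ), HullCover Q D x ∧
      (∀ k, AffineIndependent ℝ ((↑) : D k → Fin d → ℝ)) ∧
      ⨅ k, vectorSpan ℝ (D k : Set (Fin d → ℝ)) = ⊥ := by
  classical
  have hex : ∃ m, ∃ (D : Fin (r + 1) → Finset (Fin d → ℝ)) (x : Fin d → ℝ), HullCover Q D x ∧
      ∑ k, (D k).card = m := by
    obtain ⟨D, x, h1, h2, h3⟩ := exists_tverberg hQ
    exact ⟨_, D, x, ⟨h1, h2, h3⟩, rfl⟩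
  obtain ⟨D, x, hD, hcard⟩ := Nat.find_spec hex
  have hmin : ∀ D' x', HullCover Q D' x' → ∑ k, (D k).card ≤ ∑ k, (D' k).card :=
    fun D' x' h' => hcard ▸ Nat.find_min' hex ⟨D', x', h', rfl⟩
  refine ⟨D, x, hD, fun k => ?_, ?_⟩
  · by_contra hcon
    obtain ⟨f, hf1, hf0, p, hp, hne⟩ := exists_nontrivial_relation_sum_zero_of_not_affine_ind hcon
    refine hne ?_
    -- A dependency inside a single class leaves x in place, so it counts as a simultaneous one with
    -- u = 0.
    have := hD.weights_eq_zero hmin (μ := fun l => if l = k then f else 0) (u := 0)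
      (fun l => ?_) (fun l => ?_) k p hp
    · simpa using this
    · split_ifs with hl
      · rw [hl, hf0]
      · simp
    · split_ifs with hl
      · rw [hl, hf1]
      · simp
  · rw [eq_bot_iff]
    intro u hu
    rw [Submodule.mem_iInf] at hu
    choose μ hμ0 hμu using fun k => exists_weights_of_mem_vectorSpan (hu k)
    have := hD.weights_eq_zero hmin hμ0 hμu
    rw [Submodule.mem_bot, ← hμu 0]
    exact Finset.sum_eq_zero fun p hp => by rw [this 0 p hp, zero_smul]

/-! ### Subspaces with trivial intersection. -/

/-- If `d + 1` subspaces of a `d`-dimensional space intersect trivially, then either fewer than `d`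
of them already do, or some `d` of them do and these are all hyperplanes. -/
theorem exists_small_subfamily_or_hyperplanes {K V ι : Type*} [Field K] [AddCommGroup V]
    [Module K V] [FiniteDimensional K V] [Fintype ι] [DecidableEq ι] (L : ι → Submodule K V)
    (hι : Fintype.card ι = Module.finrank K V + 1) (hL : ⨅ i, L i = ⊥) :
    (∃ I : Finset ι, I.card < Module.finrank K V ∧ ⨅ i ∈ I, L i = ⊥) ∨
      ∃ j, ⨅ i ∈ Finset.univ.erase j, L i = ⊥ ∧
        ∀ i, i ≠ j → Module.finrank K (L i) + 1 = Module.finrank K V := by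
  have hex : ∃ m, ∃ I : Finset ι, ⨅ i ∈ I, L i = ⊥ ∧ I.card = m :=
    ⟨_, Finset.univ, by simpa using hL, rfl⟩
  obtain ⟨I, hI, hcard⟩ := Nat.find_spec hex
  -- In a smallest subfamily every L i is needed, which gives u i in all the others but not in L i.
  -- These vectors are independent: otherwise some u i would be a combination of the other u k, all
  -- in L i.
  have hmin : ∀ i ∈ I, ∃ u ∈ ⨅ k ∈ I.erase i, L k, u ≠ 0 := by
    intro i hi
    refine Submodule.exists_mem_ne_zero_of_ne_bot fun hbot => ?_
    have := Nat.find_min' hex ⟨I.erase i, hbot, rfl⟩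
    rw [← hcard] at this
    exact absurd this (not_le.2 (Finset.card_erase_lt_of_mem hi))
  choose! u hu hu0 using hmin
  have hmem : ∀ i ∈ I, ∀ k ∈ I, k ≠ i → u i ∈ L k := fun i hi k hk hki => by
    have := hu i hi
    simp only [Submodule.mem_iInf] at this
    exact this k (Finset.mem_erase.2 ⟨hki, hk⟩)
  have hnot : ∀ i ∈ I, u i ∉ L i := fun i hi hmi => hu0 i hi <| by
    rw [← Submodule.mem_bot K, ← hI]
    simp only [Submodule.mem_iInf]
    intro k hk
    rcases eq_or_ne k i with rfl | hki
    exacts [hmi, hmem i hi k hk hki]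
  have hlin : LinearIndependent K fun i : I => u i := by
    rw [Fintype.linearIndependent_iff]
    intro c hc i
    by_contra hci
    apply hnot i i.2
    rw [← Finset.add_sum_erase _ _ (Finset.mem_univ i)] at hc
    have h1 : c i • u i ∈ L i := by
      rw [eq_neg_of_add_eq_zero_left hc]
      refine neg_mem (sum_mem fun k hk => (L i).smul_mem _ (hmem k k.2 i i.2 fun h => ?_))
      exact (Finset.mem_erase.1 hk).1 (Subtype.ext h.symm)
    exact ((L i).smul_mem_iff hci).1 h1
  have hle : I.card ≤ Module.finrank K V := by simpa using hlin.fintype_card_le_finrank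
  rcases hle.lt_or_eq with hlt | heq
  · exact Or.inl ⟨I, hlt, hI⟩
  right
  obtain ⟨j, hj⟩ : ∃ j, Iᶜ = {j} := Finset.card_eq_one.1 (by rw [Finset.card_compl]; omega)
  have hIj : I = Finset.univ.erase j := by
    rw [← compl_compl I, hj, Finset.erase_eq, Finset.compl_eq_univ_sdiff]
  refine ⟨j, hIj ▸ hI, fun i hij => ?_⟩
  have hi : i ∈ I := by simp [hIj, hij]
  apply le_antisymm
  · refine Nat.succ_le_of_lt (Submodule.finrank_lt fun htop => hnot i hi ?_)
    rw [htop]; exact Submodule.mem_top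
  -- L i contains the other dim V − 1 independent vectors, so it is a hyperplane.
  · have hsub : Submodule.span K (Set.range fun k : I.erase i => u k) ≤ L i := by
      rw [Submodule.span_le]
      rintro _ ⟨k, rfl⟩
      exact hmem k (Finset.mem_of_mem_erase k.2) i hi (Finset.ne_of_mem_erase k.2).symm
    have hlin' : LinearIndependent K fun k : I.erase i => u k :=
      hlin.comp (fun k : I.erase i => (⟨k, Finset.mem_of_mem_erase k.2⟩ : I))
        fun a b hab => Subtype.ext (congrArg (fun z : I => (z : ι)) hab)
    have := Submodule.finrank_mono hsub
    rw [finrank_span_eq_card hlin', Fintype.card_coe, Finset.card_erase_of_mem hi] at this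
    omega

/-- The codimensions of subspaces with trivial intersection add up to at least the dimension. -/
theorem finrank_le_sum_codim {K V ι : Type*} [Field K] [AddCommGroup V] [Module K V]
    [FiniteDimensional K V] (I : Finset ι) (L : ι → Submodule K V) (hL : ⨅ i ∈ I, L i = ⊥) :
    Module.finrank K V ≤ ∑ i ∈ I, (Module.finrank K V - Module.finrank K (L i)) := by
  -- The kernel of the map to the product of the quotients is the intersection.
  let f : V →ₗ[K] ∀ i : I, V ⧸ L i := LinearMap.pi fun i => (L i).mkQ
  have hf : Function.Injective f := by
    rw [← LinearMap.ker_eq_bot, eq_bot_iff, ← hL]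
    intro x hx
    simp only [Submodule.mem_iInf]
    intro i hi
    have := congrFun (LinearMap.mem_ker.1 hx) ⟨i, hi⟩
    simpa [f] using this
  have := LinearMap.finrank_le_finrank_of_injective hf
  rw [Module.finrank_pi_fintype] at this
  refine this.trans (le_of_eq ?_)
  rw [← Finset.sum_coe_sort I]
  refine Finset.sum_congr rfl fun i _ => ?_
  have := (L i).finrank_quotient_add_finrank
  omega

theorem sub_mem_vectorSpan_of_mem_convexHull {E : Type*} [AddCommGroup E] [Module ℝ E] {s : Set E}
    {x y : E} (hx : x ∈ convexHull ℝ s) (hy : y ∈ convexHull ℝ s) : y - x ∈ vectorSpan ℝ s := by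
  rw [← direction_affineSpan, ← vsub_eq_sub]
  exact AffineSubspace.vsub_mem_direction (convexHull_subset_affineSpan s hy)
    (convexHull_subset_affineSpan s hx)

theorem AffineIndependent.finrank_vectorSpan_finset_add_one {E : Type*} [AddCommGroup E]
    [Module ℝ E] {s : Finset E} (h : AffineIndependent ℝ ((↑) : s → E)) (hs : s.Nonempty) :
    Module.finrank ℝ (vectorSpan ℝ (s : Set E)) + 1 = s.card := by
  have : Nonempty s := hs.to_subtype
  have key := h.finrank_vectorSpan_add_one
  rwa [show Set.range ((↑) : s → E) = (s : Set E) from Subtype.range_coe, Fintype.card_coe] at key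

/-! ### A simplex among d² + d + 1 points. -/

/-- Dropping the class `i₀` from a hull cover and using it for a simplex, the other classes can be
enlarged to a partition of the remaining points whose hulls meet in a single point, which lies in
the simplex. -/
theorem HullCover.exists_simplex {d : ℕ} {Q : Finset (Fin d → ℝ)}
    {D : Fin (d + 1) → Finset (Fin d → ℝ)} {x : Fin d → ℝ} (h : HullCover Q D x)
    (hQ : Q.card = d ^ 2 + (d + 1))
    (hind : ∀ k, AffineIndependent ℝ ((↑) : D k → Fin d → ℝ)) {i₀ j : Fin (d + 1)} (hj : j ≠ i₀)
    (hbot : ⨅ k ∈ Finset.univ.erase i₀, vectorSpan ℝ (D k : Set (Fin d → ℝ)) = ⊥)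
    (hexc : ⨅ k ∈ (Finset.univ.erase i₀).erase j, vectorSpan ℝ (D k : Set (Fin d → ℝ)) = ⊥ ∨
      ∑ k ∈ Finset.univ.erase i₀, (D k).card = d ^ 2) :
    ∃ S ⊆ Q, S.card = d + 1 ∧ ∃ D' : Fin d → Finset (Fin d → ℝ), IsPartition (Q \ S) D' ∧
      hullInter D' = {x} ∧ x ∈ convexHull ℝ (S : Set (Fin d → ℝ)) := by
  classical
  have hnonempty : ∀ k, (D k).Nonempty := fun k => by
    rw [← Finset.coe_nonempty, ← convexHull_nonempty_iff (𝕜 := ℝ)]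
    exact ⟨x, h.mem k⟩
  have hrank : ∀ k, Module.finrank ℝ (vectorSpan ℝ (D k : Set (Fin d → ℝ))) + 1 = (D k).card := by
    intro k
    exact (hind k).finrank_vectorSpan_finset_add_one (hnonempty k)
  have hrank_le : ∀ k, Module.finrank ℝ (vectorSpan ℝ (D k : Set (Fin d → ℝ))) ≤ d := fun k => by
    simpa using Submodule.finrank_le (vectorSpan ℝ (D k : Set (Fin d → ℝ)))
  have hsum : ∑ k ∈ Finset.univ.erase i₀, (D k).card ≤ d ^ 2 := by
    have h1 := finrank_le_sum_codim _ _ hbot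
    rw [Module.finrank_fin_fun] at h1
    -- By affine independence, size plus codimension is d + 1 for each class; the codimensions add
    -- up to at least d.
    have h2 : ∑ k ∈ Finset.univ.erase i₀, ((D k).card +
        (d - Module.finrank ℝ (vectorSpan ℝ (D k : Set (Fin d → ℝ))))) = d * (d + 1) := by
      rw [Finset.sum_const_nat (m := d + 1) fun k _ => ?_]
      · simp
      · have := hrank k
        have := hrank_le k
        omega
    rw [Finset.sum_add_distrib] at h2
    nlinarith
  set U := (Finset.univ.erase i₀).biUnion D with hU
  have hUQ : U ⊆ Q := Finset.biUnion_subset.2 fun k _ => h.subset k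
  have hUcard : U.card = ∑ k ∈ Finset.univ.erase i₀, (D k).card :=
    Finset.card_biUnion fun k _ l _ hkl => h.disjoint k l hkl
  have hdisj : Disjoint (D i₀) U := by
    rw [hU, Finset.disjoint_biUnion_right]
    exact fun k hk => h.disjoint _ _ (Finset.ne_of_mem_erase hk).symm
  obtain ⟨S, hDS, hSQ, hScard⟩ : ∃ S, D i₀ ⊆ S ∧ S ⊆ Q \ U ∧ S.card = d + 1 := by
    refine Finset.exists_subsuperset_card_eq (Finset.subset_sdiff.2 ⟨h.subset i₀, hdisj⟩) ?_ ?_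
    · have := hrank i₀
      have := hrank_le i₀
      omega
    · rw [Finset.card_sdiff_of_subset hUQ]
      omega
  rw [Finset.subset_sdiff] at hSQ
  set R := (Q \ S) \ U with hR
  have hRcard : R.card = d ^ 2 - ∑ k ∈ Finset.univ.erase i₀, (D k).card := by
    rw [hR, Finset.card_sdiff_of_subset (Finset.subset_sdiff.2 ⟨hUQ, hSQ.2.symm⟩),
      Finset.card_sdiff_of_subset hSQ.1, hUcard]
    omega
  -- Class j absorbs the leftover points R. Uniqueness of x survives because either j is not needed
  -- for trivial intersection or R is empty.
  let D' : Fin (d + 1) → Finset (Fin d → ℝ) := Function.update D j (D j ∪ R)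
  have hDD' : ∀ k, D k ⊆ D' k := fun k => by
    rcases eq_or_ne k j with rfl | hk
    · simp [D']
    · simp [D', hk]
  have hDU : ∀ k, k ≠ i₀ → D k ⊆ U := fun k hk =>
    Finset.subset_biUnion_of_mem D (by simp [hk])
  have hRU : Disjoint R U := Finset.sdiff_disjoint
  have hxmem : ∀ k, x ∈ convexHull ℝ (D' k : Set (Fin d → ℝ)) := fun k =>
    convexHull_mono (Finset.coe_subset.2 (hDD' k)) (h.mem k)
  refine ⟨S, hSQ.1, hScard, fun k => D' (i₀.succAbove k), ⟨fun k => ?_, fun k l hkl => ?_,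
    fun p => ⟨fun hp => ?_, ?_⟩⟩, ?_, convexHull_mono (Finset.coe_subset.2 hDS) (h.mem i₀)⟩
  · exact (hnonempty _).mono (hDD' _)
  · have hk := Fin.succAbove_ne i₀ k
    have hl := Fin.succAbove_ne i₀ l
    have hkl' : i₀.succAbove k ≠ i₀.succAbove l := fun e => hkl (Fin.succAbove_right_injective e)
    have hdis := h.disjoint _ _ hkl'
    simp only [D', Function.update_apply]
    split_ifs with h1 h2 h2
    · exact absurd (h1.trans h2.symm) hkl'
    · rw [h1] at hdis
      exact Finset.disjoint_union_left.2 ⟨hdis, hRU.mono_right (hDU _ hl)⟩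
    · rw [h2] at hdis
      exact Finset.disjoint_union_right.2 ⟨hdis, (hRU.mono_right (hDU _ hk)).symm⟩
    · exact hdis
  · by_cases hpU : p ∈ U
    · obtain ⟨k, hk, hpk⟩ := Finset.mem_biUnion.1 hpU
      obtain ⟨l, rfl⟩ := Fin.exists_succAbove_eq (Finset.ne_of_mem_erase hk)
      exact ⟨l, hDD' _ hpk⟩
    · obtain ⟨l, hl⟩ := Fin.exists_succAbove_eq hj
      exact ⟨l, by simp [D', hl, hR, hpU, Finset.mem_sdiff.1 hp]⟩
  · rintro ⟨k, hp⟩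
    have hUS : U ⊆ Q \ S := Finset.subset_sdiff.2 ⟨hUQ, hSQ.2.symm⟩
    have hk := Fin.succAbove_ne i₀ k
    simp only [D', Function.update_apply] at hp
    split_ifs at hp with h1
    · rcases Finset.mem_union.1 hp with hp | hp
      · exact hUS (hDU j hj hp)
      · exact (Finset.mem_sdiff.1 hp).1
    · exact hUS (hDU _ hk hp)
  · refine Set.eq_singleton_iff_unique_mem.2 ⟨Set.mem_iInter.2 fun k => hxmem _, fun y hy => ?_⟩
    have hy' : ∀ k, k ≠ i₀ → y ∈ convexHull ℝ (D' k : Set (Fin d → ℝ)) := fun k hk => by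
      obtain ⟨l, rfl⟩ := Fin.exists_succAbove_eq hk
      exact Set.mem_iInter.1 hy l
    rw [← sub_eq_zero, ← Submodule.mem_bot ℝ]
    rcases hexc with hexc | hexc
    · rw [← hexc]
      simp only [Submodule.mem_iInf]
      intro k hk
      obtain ⟨hkj, hk⟩ := Finset.mem_erase.1 hk
      have := hy' k (Finset.ne_of_mem_erase hk)
      simp only [D', Function.update_of_ne hkj] at this
      exact sub_mem_vectorSpan_of_mem_convexHull (h.mem k) this
    · have hR0 : R = ∅ := by rw [← Finset.card_eq_zero, hRcard, hexc, Nat.sub_self]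
      have hD' : D' = D := by simp [D', hR0]
      rw [← hbot]
      simp only [Submodule.mem_iInf]
      intro k hk
      exact sub_mem_vectorSpan_of_mem_convexHull (h.mem k) (hD' ▸ hy' k (Finset.ne_of_mem_erase hk))

/-- Among any `d² + d + 1` points of `ℝ^d` there are `d + 1` whose hull contains the only common
point of the hulls of some `d` classes dividing the remaining `d²` points. -/
theorem exists_simplex_of_card_eq {d : ℕ} (hd : 1 ≤ d) {Q : Finset (Fin d → ℝ)}
    (hQ : Q.card = d ^ 2 + (d + 1)) :
    ∃ S ⊆ Q, S.card = d + 1 ∧ ∃ (D : Fin d → Finset (Fin d → ℝ)) (x : Fin d → ℝ),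
      IsPartition (Q \ S) D ∧ hullInter D = {x} ∧ x ∈ convexHull ℝ (S : Set (Fin d → ℝ)) := by
  classical
  obtain ⟨D, x, hD, hind, hbot⟩ := exists_independent_hullCover (r := d) (Q := Q)
    (by rw [hQ]; nlinarith)
  suffices ∃ i₀ j, j ≠ i₀ ∧
      ⨅ k ∈ Finset.univ.erase i₀, vectorSpan ℝ (D k : Set (Fin d → ℝ)) = ⊥ ∧
      (⨅ k ∈ (Finset.univ.erase i₀).erase j, vectorSpan ℝ (D k : Set (Fin d → ℝ)) = ⊥ ∨
        ∑ k ∈ Finset.univ.erase i₀, (D k).card = d ^ 2) by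
    obtain ⟨i₀, j, hj, h1, h2⟩ := this
    obtain ⟨S, hS, hc, D', h⟩ := hD.exists_simplex hQ hind hj h1 h2
    exact ⟨S, hS, hc, D', x, h⟩
  rcases exists_small_subfamily_or_hyperplanes _ (by simp) hbot with ⟨I, hI, hIbot⟩ | ⟨i₀, h1, h2⟩
  · rw [Module.finrank_fin_fun] at hI
    obtain ⟨i₀, hi₀, j, hj, hne⟩ := Finset.one_lt_card.1 (show 1 < Iᶜ.card by
      rw [Finset.card_compl, Fintype.card_fin]; omega)
    rw [Finset.mem_compl] at hi₀ hj
    have mono : ∀ J : Finset (Fin (d + 1)), I ⊆ J →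
        ⨅ k ∈ J, vectorSpan ℝ (D k : Set (Fin d → ℝ)) = ⊥ := fun J hJ =>
      eq_bot_iff.2 (hIbot ▸ biInf_mono hJ)
    exact ⟨i₀, j, hne.symm, mono _ (Finset.subset_erase.2 ⟨Finset.subset_univ _, hi₀⟩),
      Or.inl (mono _ (Finset.subset_erase.2
        ⟨Finset.subset_erase.2 ⟨Finset.subset_univ _, hi₀⟩, hj⟩))⟩
  · have : Nontrivial (Fin (d + 1)) := Fin.nontrivial_iff_two_le.2 (by omega)
    obtain ⟨j, hj⟩ := exists_ne i₀
    refine ⟨i₀, j, hj, h1, Or.inr ?_⟩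
    rw [Finset.sum_const_nat (m := d) fun k hk => ?_]
    · simp [sq]
    · have hne : (D k).Nonempty := by
        rw [← Finset.coe_nonempty, ← convexHull_nonempty_iff (𝕜 := ℝ)]
        exact ⟨x, hD.mem k⟩
      have h3 := (hind k).finrank_vectorSpan_finset_add_one hne
      have h4 := h2 k (Finset.ne_of_mem_erase hk)
      rw [Module.finrank_fin_fun] at h4
      omega

/-! ### Double counting. -/

/-- By Pascal's rule, raising the upper index by one costs at most a factor k + 1. This later
replaces C(n − s, k) by C(n, k). -/
theorem Nat.choose_add_le_pow_mul_choose {n k : ℕ} (h : k ≤ n) (s : ℕ) :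
    (n + s).choose k ≤ (k + 1) ^ s * n.choose k := by
  induction s with
  | zero => simp
  | succ s ih =>
    have step : (n + s + 1).choose k ≤ (k + 1) * (n + s).choose k := by
      cases k with
      | zero => simp
      | succ k =>
        rw [Nat.choose_succ_succ]
        have h1 := Nat.choose_succ_right_eq (n + s) k
        have h2 : (n + s).choose k * 1 ≤ (n + s).choose k * (n + s - k) :=
          Nat.mul_le_mul_left _ (by omega)
        nlinarith
    calc (n + (s + 1)).choose k ≤ (k + 1) * (n + s).choose k := step
      _ ≤ (k + 1) * ((k + 1) ^ s * n.choose k) := Nat.mul_le_mul_left _ ih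
      _ = (k + 1) ^ (s + 1) * n.choose k := by ring

/-- The number of `m`-element subsets of `P` containing a given subset `R`. -/
theorem Finset.card_filter_powersetCard_superset_le {α : Type*} [DecidableEq α] {P R : Finset α}
    (hR : R ⊆ P) (m : ℕ) :
    ((P.powersetCard m).filter (R ⊆ ·)).card ≤ (P.card - R.card).choose (m - R.card) := by
  rw [← Finset.card_sdiff_of_subset hR, ← Finset.card_powersetCard]
  refine Finset.card_le_card_of_injOn (· \ R) (fun M hM => ?_) fun M hM N hN h => ?_
  · obtain ⟨hMP, hRM⟩ := Finset.mem_filter.1 (Finset.mem_coe.1 hM)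
    rw [Finset.mem_powersetCard] at hMP
    exact Finset.mem_coe.2 (Finset.mem_powersetCard.2 ⟨Finset.sdiff_subset_sdiff hMP.1 le_rfl,
      by rw [Finset.card_sdiff_of_subset hRM, hMP.2]⟩)
  · rw [← Finset.sdiff_union_of_subset (Finset.mem_filter.1 (Finset.mem_coe.1 hM)).2,
      ← Finset.sdiff_union_of_subset (Finset.mem_filter.1 (Finset.mem_coe.1 hN)).2]
    exact congrArg (· ∪ R) h

/-- If every `m`-element subset of `P` contains disjoint sets `S` and `Q` of sizes `s` and `k` in
the relation `G`, then some `S` is related to a positive fraction of the `k`-element subsets. -/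
theorem exists_popular_subset {α : Type*} [DecidableEq α] {s k m n : ℕ} (hm : s + k ≤ m)
    (hn : m ≤ n) {P : Finset α} (hP : P.card = n) (G : Finset α → Finset α → Prop)
    [∀ S, DecidablePred (G S)]
    (hG : ∀ M ⊆ P, M.card = m → ∃ S ⊆ M, ∃ Q ⊆ M, S.card = s ∧ Q.card = k ∧ Disjoint S Q ∧ G S Q) :
    ∃ S ⊆ P, S.card = s ∧ n.choose k ≤ (k + 1) ^ s * ((s + k).choose s * m.choose (s + k)) *
      ((P.powersetCard k).filter (G S)).card := by
  obtain ⟨S₀, hS₀, hmax⟩ := Finset.exists_max_image (P.powersetCard s)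
    (fun S => ((P.powersetCard k).filter (G S)).card)
    (Finset.powersetCard_nonempty.2 (by omega))
  rw [Finset.mem_powersetCard] at hS₀
  refine ⟨S₀, hS₀.1, hS₀.2, ?_⟩
  set X := ((P.powersetCard k).filter (G S₀)).card
  let T := (P.powersetCard s ×ˢ P.powersetCard k).filter fun z => Disjoint z.1 z.2 ∧ G z.1 z.2
  have hT : ∀ z ∈ T, (z.1 ⊆ P ∧ z.1.card = s) ∧ (z.2 ⊆ P ∧ z.2.card = k) ∧
      Disjoint z.1 z.2 ∧ G z.1 z.2 := fun z hz => by
    simpa [T, Finset.mem_powersetCard, and_assoc] using hz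
  have hTX : T.card ≤ X * n.choose s := by
    rw [← hP, ← Finset.card_powersetCard]
    refine Finset.card_le_mul_card_image_of_maps_to (f := Prod.fst)
      (fun z hz => Finset.mem_powersetCard.2 (hT z hz).1) _ fun S hS => ?_
    refine le_trans (Finset.card_le_card_of_injOn Prod.snd (fun z hz => ?_) fun z hz z' hz' h => ?_)
      (hmax S hS)
    · obtain ⟨hzT, rfl⟩ := Finset.mem_filter.1 (Finset.mem_coe.1 hz)
      exact Finset.mem_coe.2 (Finset.mem_filter.2
        ⟨Finset.mem_powersetCard.2 (hT z hzT).2.1, (hT z hzT).2.2.2⟩)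
    · exact Prod.ext ((Finset.mem_filter.1 (Finset.mem_coe.1 hz)).2.trans
        (Finset.mem_filter.1 (Finset.mem_coe.1 hz')).2.symm) h
  -- Each m-subset contains the union of a pair in T, and each such union of size s + k lies in at
  -- most C(n − s − k, m − s − k) of them.
  have hcover : n.choose m ≤ T.card * (n - (s + k)).choose (m - (s + k)) := by
    rw [← hP, ← Finset.card_powersetCard]
    calc (P.powersetCard m).card
        ≤ (T.biUnion fun z => (P.powersetCard m).filter (z.1 ∪ z.2 ⊆ ·)).card := by
          refine Finset.card_le_card fun M hM => ?_
          obtain ⟨hMP, hMm⟩ := Finset.mem_powersetCard.1 hM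
          obtain ⟨S, hS, Q, hQ, h1, h2, h3, h4⟩ := hG M hMP hMm
          refine Finset.mem_biUnion.2 ⟨(S, Q), ?_, Finset.mem_filter.2 ⟨hM, Finset.union_subset hS hQ⟩⟩
          simp only [T, Finset.mem_filter, Finset.mem_product, Finset.mem_powersetCard]
          exact ⟨⟨⟨hS.trans hMP, h1⟩, hQ.trans hMP, h2⟩, h3, h4⟩
      _ ≤ _ := by
          refine Finset.card_biUnion_le_card_mul _ _ _ fun z hz => ?_
          obtain ⟨⟨h1, h1'⟩, ⟨h2, h2'⟩, h3, -⟩ := hT z hz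
          have := Finset.card_filter_powersetCard_superset_le (Finset.union_subset h1 h2) m
          rwa [Finset.card_union_of_disjoint h3, h1', h2'] at this
  have e1 : n.choose m * m.choose (s + k) =
      n.choose (s + k) * (n - (s + k)).choose (m - (s + k)) := Nat.choose_mul hm
  have e2 : n.choose (s + k) * (s + k).choose s = n.choose s * (n - s).choose k := by
    have := Nat.choose_mul (n := n) (k := s + k) (s := s) (by omega)
    rwa [Nat.add_sub_cancel_left] at this
  have hA : 0 < n.choose s := Nat.choose_pos (by omega)
  have hB : 0 < (n - (s + k)).choose (m - (s + k)) := Nat.choose_pos (by omega)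
  have h1 : n.choose (s + k) ≤ m.choose (s + k) * (X * n.choose s) := by
    refine Nat.le_of_mul_le_mul_right ?_ hB
    rw [← e1, mul_comm (n.choose m), mul_assoc]
    exact Nat.mul_le_mul_left _ (hcover.trans (Nat.mul_le_mul_right _ hTX))
  have h2 : (n - s).choose k ≤ (s + k).choose s * m.choose (s + k) * X := by
    refine Nat.le_of_mul_le_mul_left ?_ hA
    rw [← e2]
    calc n.choose (s + k) * (s + k).choose s
        ≤ m.choose (s + k) * (X * n.choose s) * (s + k).choose s := Nat.mul_le_mul_right _ h1
      _ = _ := by ring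
  calc n.choose k = (n - s + s).choose k := by rw [Nat.sub_add_cancel (by omega)]
    _ ≤ (k + 1) ^ s * (n - s).choose k := Nat.choose_add_le_pow_mul_choose (by omega) s
    _ ≤ (k + 1) ^ s * ((s + k).choose s * m.choose (s + k) * X) := Nat.mul_le_mul_left _ h2
    _ = _ := by ring

/-! ### Crossing segments in the plane. -/

/-- An affine dependency of five points of the plane in general position that vanishes at two of
them vanishes at all of them. -/
theorem InGeneralPosition.dependency_eq_zero {p : Fin 5 → Fin 2 → ℝ} (hp : Function.Injective p)
    (hgp : InGeneralPosition (Finset.univ.image p)) {w : Fin 5 → ℝ} (hw : ∑ i, w i = 0)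
    (hwp : ∑ i, w i • p i = 0) {i j : Fin 5} (hij : i ≠ j) (hi : w i = 0) (hj : w j = 0) :
    w = 0 := by
  funext k
  by_contra hk
  simp only [Pi.zero_apply] at hk
  have hki : k ≠ i := fun h => hk (h ▸ hi)
  have hkj : k ≠ j := fun h => hk (h ▸ hj)
  obtain ⟨q, r, hqr, hqr'⟩ : ∃ q r, q ≠ r ∧ ({i, j, k} : Finset (Fin 5))ᶜ = {q, r} := by
    rw [← Finset.card_eq_two, Finset.card_compl]
    rw [Finset.card_eq_three.2 ⟨i, j, k, hij, hki.symm, hkj.symm, rfl⟩]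
    rfl
  have hq : q ≠ k := fun h => by
    have : q ∈ ({i, j, k} : Finset (Fin 5))ᶜ := by simp [hqr']
    simp [h] at this
  have hr : r ≠ k := fun h => by
    have : r ∈ ({i, j, k} : Finset (Fin 5))ᶜ := by simp [hqr']
    simp [h] at this
  have hsum : ∀ f : Fin 5 → ℝ, ∑ l, w l * f l = w k * f k + w q * f q + w r * f r := by
    intro f
    rw [← Finset.sum_add_sum_compl {i, j, k}, hqr', Finset.sum_pair hqr, Finset.sum_insert,
      Finset.sum_pair hkj.symm, hi, hj]
    · ring
    · simp [hij, hki.symm]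
  have h0 := hsum fun _ => 1
  have h1 : ∀ c, ∑ l, w l * p l c = 0 := fun c => by simpa using congrFun hwp c
  have hx := (h1 0).symm.trans (hsum fun l => p l 0)
  have hy := (h1 1).symm.trans (hsum fun l => p l 1)
  simp only [mul_one, hw] at h0
  -- The line through p q and p r also contains p k, since the dependency now involves only these
  -- three points and w k ≠ 0.
  refine hgp {p k, p q, p r} ?_ ?_ ⟨![-(p q 1 - p r 1), p q 0 - p r 0],
    p q 0 * p r 1 - p q 1 * p r 0, fun h => hqr (hp ?_), ?_⟩
  · simp [Finset.insert_subset_iff]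
  · exact Finset.card_eq_three.2 ⟨_, _, _, hp.ne hq.symm, hp.ne hr.symm, hp.ne hqr, rfl⟩
  · have e0 := congrFun h 0
    have e1 := congrFun h 1
    simp at e0 e1
    funext c
    fin_cases c
    · simp; linarith
    · simp; linarith
  · intro z hz
    simp only [Finset.mem_insert, Finset.mem_singleton] at hz
    rcases hz with rfl | rfl | rfl
    · simp only [dotProduct, Fin.sum_univ_two, Matrix.cons_val_zero, Matrix.cons_val_one]
      refine mul_left_cancel₀ hk ?_
      linear_combination (p q 0 * p r 1 - p q 1 * p r 0) * h0 + (p q 1 - p r 1) * hx -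
        (p q 0 - p r 0) * hy
    · simp [dotProduct, Fin.sum_univ_two]; ring
    · simp [dotProduct, Fin.sum_univ_two]; ring

/-- `Q` consists of the endpoints of two segments crossing at `c`. -/
def IsCrossingQuadruple (Q : Finset (Fin 2 → ℝ)) (c : Fin 2 → ℝ) : Prop :=
  ∃ a b u v, [a, b, u, v].Nodup ∧ Q = {a, b, u, v} ∧ c ∈ openSegment ℝ a b ∩ openSegment ℝ u v

theorem IsCrossingQuadruple.card_eq {Q : Finset (Fin 2 → ℝ)} {c : Fin 2 → ℝ}
    (h : IsCrossingQuadruple Q c) : Q.card = 4 := by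
  obtain ⟨a, b, u, v, hn, rfl, -⟩ := h
  have : ({a, b, u, v} : Finset (Fin 2 → ℝ)) = [a, b, u, v].toFinset := by simp
  rw [this, List.toFinset_card_of_nodup hn]
  rfl

theorem IsCrossingQuadruple.mem_convexHull {Q : Finset (Fin 2 → ℝ)} {c : Fin 2 → ℝ}
    (h : IsCrossingQuadruple Q c) : c ∈ convexHull ℝ (Q : Set (Fin 2 → ℝ)) := by
  obtain ⟨a, b, u, v, hn, rfl, hc, -⟩ := h
  refine (convex_convexHull ℝ _).openSegment_subset ?_ ?_ hc <;>
    exact subset_convexHull _ _ (by simp)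

/-- A tournament on five vertices has a vertex of even outdegree. -/
theorem exists_even_card_pos {μ : Fin 5 → Fin 5 → ℝ} (hanti : ∀ i j, μ i j = -μ j i)
    (hne : ∀ i j, i ≠ j → μ i j ≠ 0) : ∃ i, Even (Finset.card {j | 0 < μ i j}) := by
  by_contra! hcon
  -- 20 is the number of ordered pairs of distinct vertices. The outdegrees thus sum to 10, whereas
  -- five odd numbers have an odd sum.
  have hsum : 2 * ∑ i, Finset.card {j | 0 < μ i j} = 20 := by
    rw [two_mul]
    simp only [Finset.card_filter]
    nth_rewrite 2 [Finset.sum_comm]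
    simp only [← Finset.sum_add_distrib]
    have : ∀ i j, ((if 0 < μ i j then 1 else 0) + if 0 < μ j i then 1 else 0) =
        if i ≠ j then 1 else 0 := by
      intro i j
      have h := hanti j i
      rcases eq_or_ne i j with rfl | hij
      · have : μ i i = 0 := by linarith
        simp [this]
      · rcases lt_or_gt_of_ne (hne i j hij) with h' | h'
        · rw [if_neg (by linarith), if_pos (by linarith), if_pos hij]
        · rw [if_pos (by linarith), if_neg (by linarith), if_pos hij]
    simp only [this]
    decide
  have hodd : Odd (∑ i, Finset.card {j | 0 < μ i j}) := by
    rw [Finset.odd_sum_iff_odd_card_odd, Finset.filter_true_of_mem fun i _ => ?_]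
    · decide
    · exact Nat.not_even_iff_odd.1 (hcon i)
  obtain ⟨t, ht⟩ := hodd
  omega

/-- Five points of the plane in general position include the endpoints of two crossing segments. -/
theorem InGeneralPosition.exists_crossingQuadruple {A : Finset (Fin 2 → ℝ)} (hA : A.card = 5)
    (hgp : InGeneralPosition A) : ∃ Q ⊆ A, ∃ c, IsCrossingQuadruple Q c := by
  obtain ⟨p, hp, rfl⟩ : ∃ p : Fin 5 → Fin 2 → ℝ, Function.Injective p ∧
      Finset.univ.image p = A := by
    let e := (Finset.equivFinOfCardEq hA).symm
    refine ⟨fun i => e i, Subtype.val_injective.comp e.injective, ?_⟩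
    ext z
    simp only [Finset.mem_image, Finset.mem_univ, true_and]
    exact ⟨by rintro ⟨i, rfl⟩; exact (e i).2, fun hz => ⟨e.symm ⟨z, hz⟩, by simp⟩⟩
  let f : (Fin 5 → ℝ) →ₗ[ℝ] ℝ × (Fin 2 → ℝ) :=
    (Fintype.linearCombination ℝ fun _ => (1 : ℝ)).prod (Fintype.linearCombination ℝ p)
  have hmem : ∀ w, w ∈ LinearMap.ker f ↔ ∑ i, w i = 0 ∧ ∑ i, w i • p i = 0 := fun w => by
    simp [f, Fintype.linearCombination_apply]
  have hker : 2 ≤ Module.finrank ℝ (LinearMap.ker f) := by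
    have h1 := f.finrank_range_add_finrank_ker
    have h2 := Submodule.finrank_le (LinearMap.range f)
    simp at h1 h2
    omega
  obtain ⟨g, hg⟩ := exists_linearIndependent_of_le_finrank hker
  have hg' : LinearIndependent ℝ fun i => (g i).1 :=
    hg.map' (LinearMap.ker f).subtype (Submodule.ker_subtype _)
  let α : Fin 5 → ℝ := (g 0).1
  let β : Fin 5 → ℝ := (g 1).1
  have hpair : ∀ s t : ℝ, s • α + t • β = 0 → s = 0 ∧ t = 0 := by
    have : LinearIndependent ℝ ![α, β] := by
      convert hg' using 1
      funext i
      fin_cases i <;> rfl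
    exact LinearIndependent.pair_iff.1 this
  -- μ i is the combination of the dependencies α, β that vanishes at i. General position makes its
  -- other entries nonzero, so the signs of the antisymmetric μ form a tournament. A vertex of even
  -- outdegree gives signs 2 + 2 on the other four points: two crossing segments.
  let μ : Fin 5 → Fin 5 → ℝ := fun i j => α i * β j - β i * α j
  have hμker : ∀ i, μ i ∈ LinearMap.ker f := fun i =>
    sub_mem (Submodule.smul_mem _ (α i) (g 1).2) (Submodule.smul_mem _ (β i) (g 0).2)
  have hμzero : ∀ i, μ i = 0 → α i = 0 ∧ β i = 0 := fun i h => by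
    have := hpair (-β i) (α i) (by
      rw [← h]; funext j; simp [μ]; ring)
    exact ⟨this.2, neg_eq_zero.1 this.1⟩
  have hμdep : ∀ i j, i ≠ j → μ i j = 0 → μ i = 0 := fun i j hij h =>
    hgp.dependency_eq_zero hp ((hmem _).1 (hμker i)).1 ((hmem _).1 (hμker i)).2 hij
      (by simp [μ]; ring) h
  have hμne : ∀ i j, i ≠ j → μ i j ≠ 0 := by
    intro i j hij h
    have hi := hμzero i (hμdep i j hij h)
    have hall : ∀ k, α k = 0 := fun k => by
      rcases eq_or_ne k i with rfl | hk
      · exact hi.1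
      · exact (hμzero k (hμdep k i hk (by simp [μ, hi]))).1
    have hα0 : α = 0 := funext hall
    exact one_ne_zero (hpair 1 0 (by simp [hα0])).1
  obtain ⟨i, hi⟩ := exists_even_card_pos (μ := μ) (fun i j => by simp only [μ]; ring) hμne
  have hμi : ∑ j, μ i j = 0 := ((hmem _).1 (hμker i)).1
  have hμip : ∑ j, μ i j • p j = 0 := ((hmem _).1 (hμker i)).2
  have hii : μ i i = 0 := by simp only [μ]; ring
  have hpn : Finset.card {j | 0 < μ i j} + Finset.card {j | μ i j < 0} = 4 := by
    rw [← Finset.card_union_of_disjoint (Finset.disjoint_filter.2 fun j _ h h' => lt_asymm h h')]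
    have : (Finset.univ.filter fun j => 0 < μ i j) ∪ (Finset.univ.filter fun j => μ i j < 0) =
        Finset.univ.erase i := by
      ext j
      simp only [Finset.mem_union, Finset.mem_filter, Finset.mem_univ, true_and, Finset.mem_erase,
        and_true]
      constructor
      · rintro h rfl
        rw [hii] at h
        simp at h
      · exact fun h => (hμne i j h.symm).lt_or_gt.symm
    rw [this, Finset.card_erase_of_mem (Finset.mem_univ _)]
    rfl
  obtain ⟨j, hj⟩ := exists_ne i
  have hpos : 0 < Finset.card {j | 0 < μ i j} := by
    by_contra! hcon
    rw [Nat.le_zero, Finset.card_eq_zero, Finset.filter_eq_empty_iff] at hcon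
    exact hμne i j hj.symm ((Finset.sum_eq_zero_iff_of_nonpos fun k _ =>
      not_lt.1 (hcon (Finset.mem_univ k))).1 hμi j (Finset.mem_univ j))
  have hneg : 0 < Finset.card {j | μ i j < 0} := by
    by_contra! hcon
    rw [Nat.le_zero, Finset.card_eq_zero, Finset.filter_eq_empty_iff] at hcon
    exact hμne i j hj.symm ((Finset.sum_eq_zero_iff_of_nonneg fun k _ =>
      not_lt.1 (hcon (Finset.mem_univ k))).1 hμi j (Finset.mem_univ j))
  obtain ⟨t, ht⟩ := hi
  obtain ⟨a, b, hab, hpab⟩ := Finset.card_eq_two.1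
    (show Finset.card {j | 0 < μ i j} = 2 by omega)
  obtain ⟨u, v, huv, hnuv⟩ := Finset.card_eq_two.1
    (show Finset.card {j | μ i j < 0} = 2 by omega)
  have ha : 0 < μ i a := by
    have : a ∈ ({j | 0 < μ i j} : Finset (Fin 5)) := by simp [hpab]
    simpa using this
  have hb : 0 < μ i b := by
    have : b ∈ ({j | 0 < μ i j} : Finset (Fin 5)) := by simp [hpab]
    simpa using this
  have hu : μ i u < 0 := by
    have : u ∈ ({j | μ i j < 0} : Finset (Fin 5)) := by simp [hnuv]
    simpa using this
  have hv : μ i v < 0 := by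
    have : v ∈ ({j | μ i j < 0} : Finset (Fin 5)) := by simp [hnuv]
    simpa using this
  have hsum : ∀ {E : Type} [AddCommGroup E] [Module ℝ E] (q : Fin 5 → E),
      ∑ j, μ i j • q j = (μ i a • q a + μ i b • q b) + (μ i u • q u + μ i v • q v) := by
    intro E _ _ q
    rw [← Finset.sum_pair (f := fun j => μ i j • q j) hab,
      ← Finset.sum_pair (f := fun j => μ i j • q j) huv, ← hpab, ← hnuv, ← Finset.sum_union
      (Finset.disjoint_filter.2 fun j _ h h' => lt_asymm h h')]
    refine (Finset.sum_subset (Finset.subset_univ _) fun j _ hj => ?_).symm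
    simp only [Finset.mem_union, Finset.mem_filter, Finset.mem_univ, true_and, not_or,
      not_lt] at hj
    rw [le_antisymm hj.1 hj.2, zero_smul]
  have h1 := hsum fun _ => (1 : ℝ)
  simp only [smul_eq_mul, mul_one, hμi] at h1
  have h2 := hsum p
  rw [hμip] at h2
  set W := μ i a + μ i b with hW
  have hWpos : 0 < W := add_pos ha hb
  refine ⟨{p a, p b, p u, p v}, by simp [Finset.insert_subset_iff],
    W⁻¹ • (μ i a • p a + μ i b • p b), p a, p b, p u, p v, ?_, rfl, ?_, ?_⟩
  · have hau : a ≠ u := fun h => lt_asymm ha (h ▸ hu)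
    have hav : a ≠ v := fun h => lt_asymm ha (h ▸ hv)
    have hbu : b ≠ u := fun h => lt_asymm hb (h ▸ hu)
    have hbv : b ≠ v := fun h => lt_asymm hb (h ▸ hv)
    simp [hp.eq_iff, hab, hau, hav, hbu, hbv, huv]
  · refine ⟨W⁻¹ * μ i a, W⁻¹ * μ i b, by positivity, by positivity, ?_, ?_⟩
    · rw [← mul_add, ← hW, inv_mul_cancel₀ hWpos.ne']
    · rw [smul_add, smul_smul, smul_smul]
  · refine ⟨W⁻¹ * -μ i u, W⁻¹ * -μ i v, mul_pos (inv_pos.2 hWpos) (neg_pos.2 hu),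
      mul_pos (inv_pos.2 hWpos) (neg_pos.2 hv), ?_, ?_⟩
    · rw [← mul_add, show -μ i u + -μ i v = W by linarith, inv_mul_cancel₀ hWpos.ne']
    · rw [eq_neg_of_add_eq_zero_left h2.symm, mul_smul, mul_smul, ← smul_add, neg_smul, neg_smul,
        neg_add]

theorem InGeneralPosition.mono {d : ℕ} {P A : Finset (Fin d → ℝ)} (h : InGeneralPosition P)
    (hA : A ⊆ P) : InGeneralPosition A :=
  fun S hS => h S (hS.trans hA)

/-- Among `4 k + 1` points in general position one finds `k` disjoint crossing quadruples. -/
theorem InGeneralPosition.exists_disjoint_crossingQuadruples (k : ℕ) {A : Finset (Fin 2 → ℝ)}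
    (hA : 4 * k + 1 ≤ A.card) (hgp : InGeneralPosition A) :
    ∃ (Q : Fin k → Finset (Fin 2 → ℝ)) (c : Fin k → Fin 2 → ℝ), (∀ i, Q i ⊆ A) ∧
      (∀ i, IsCrossingQuadruple (Q i) (c i)) ∧ ∀ i j, i ≠ j → Disjoint (Q i) (Q j) := by
  induction k generalizing A with
  | zero => exact ⟨Fin.elim0, Fin.elim0, fun i => i.elim0, fun i => i.elim0, fun i => i.elim0⟩
  | succ k ih =>
    obtain ⟨B, hB, hB5⟩ := Finset.exists_subset_card_eq (show 5 ≤ A.card by omega)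
    obtain ⟨Q₀, hQ₀, c₀, hc₀⟩ := (hgp.mono hB).exists_crossingQuadruple hB5
    have hQ₀A := hQ₀.trans hB
    obtain ⟨Q, c, h1, h2, h3⟩ := ih (A := A \ Q₀)
      (by rw [Finset.card_sdiff_of_subset hQ₀A, hc₀.card_eq]; omega)
      (hgp.mono Finset.sdiff_subset)
    simp only [Finset.subset_sdiff] at h1
    refine ⟨Fin.cons Q₀ Q, Fin.cons c₀ c, ?_, ?_, ?_⟩
    · exact Fin.cases hQ₀A fun i => (h1 i).1
    · exact Fin.cases hc₀ h2
    · refine Fin.cases (Fin.cases (fun h => absurd rfl h) fun j _ => (h1 j).2.symm) fun i =>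
        Fin.cases (fun _ => (h1 i).2) fun j hij => h3 i j fun h => hij (h ▸ rfl)

/-- Seven points in convex position consist of a triangle and two segments crossing inside it. -/
theorem exists_crossing_in_triangle_of_convex {A : Finset (Fin 2 → ℝ)} (hA : A.card = 7)
    (hconv : ∀ a ∈ A, a ∉ convexHull ℝ ((A.erase a : Finset (Fin 2 → ℝ)) : Set (Fin 2 → ℝ))) :
    ∃ S ⊆ A, S.card = 3 ∧ ∃ x, IsCrossingQuadruple (A \ S) x ∧
      x ∈ convexHull ℝ (S : Set (Fin 2 → ℝ)) := by
  obtain ⟨S, hSA, hS, D, x, hD, hDx, hxS⟩ := exists_simplex_of_card_eq (d := 2) (by norm_num) hA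
  refine ⟨S, hSA, hS, x, ?_, hxS⟩
  have hx : ∀ i, x ∈ convexHull ℝ (D i : Set (Fin 2 → ℝ)) := fun i =>
    Set.mem_iInter.1 (show x ∈ hullInter D by simp [hDx]) i
  have hne : ∀ p ∈ A \ S, x ≠ p := by
    rintro p hp rfl
    rw [Finset.mem_sdiff] at hp
    exact hconv x hp.1 (convexHull_mono (Finset.coe_subset.2
      (Finset.subset_erase.2 ⟨hSA, hp.2⟩)) hxS)
  have hDsub : ∀ i, D i ⊆ A \ S := fun i p hp => (hD.cover p).2 ⟨i, hp⟩
  -- A singleton class would make x a point of A outside S but in the hull of S, against convex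
  -- position. So the four points split 2 + 2.
  have hone : ∀ i, (D i).card ≠ 1 := fun i h => by
    obtain ⟨p, hp⟩ := Finset.card_eq_one.1 h
    have := hx i
    rw [hp, Finset.coe_singleton, convexHull_singleton] at this
    exact hne p (hDsub i (by simp [hp])) this
  have hunion : A \ S = D 0 ∪ D 1 := by
    ext p
    rw [hD.cover, Fin.exists_fin_two, Finset.mem_union]
  have hdisj := hD.disjoint 0 1 (by decide)
  have hcard : (D 0).card + (D 1).card = 4 := by
    rw [← Finset.card_union_of_disjoint hdisj, ← hunion, Finset.card_sdiff_of_subset hSA, hA, hS]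
  have h0 := (hD.nonempty 0).card_pos
  have h1 := (hD.nonempty 1).card_pos
  have h0' := hone 0
  have h1' := hone 1
  obtain ⟨a, b, hab, hDab⟩ := Finset.card_eq_two.1 (show (D 0).card = 2 by omega)
  obtain ⟨u, v, huv, hDuv⟩ := Finset.card_eq_two.1 (show (D 1).card = 2 by omega)
  have hx0 := hx 0
  have hx1 := hx 1
  rw [hDab, Finset.coe_pair, convexHull_pair] at hx0
  rw [hDuv, Finset.coe_pair, convexHull_pair] at hx1
  have ha := hne a (hDsub 0 (by simp [hDab]))
  have hb := hne b (hDsub 0 (by simp [hDab]))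
  have hu := hne u (hDsub 1 (by simp [hDuv]))
  have hv := hne v (hDsub 1 (by simp [hDuv]))
  refine ⟨a, b, u, v, ?_, ?_, mem_openSegment_of_ne_left_right ha.symm hb.symm hx0,
    mem_openSegment_of_ne_left_right hu.symm hv.symm hx1⟩
  · rw [hDab, hDuv] at hdisj
    simp only [Finset.disjoint_insert_left, Finset.disjoint_singleton_left, Finset.mem_insert,
      Finset.mem_singleton, not_or] at hdisj
    simp [hab, huv, hdisj]
  · rw [hunion, hDab, hDuv]
    rw [Finset.insert_union, Finset.singleton_union]

/-- Among 29 points in general position there are a triangle and, disjoint from its vertices, a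
crossing quadruple whose crossing lies in the triangle. -/
theorem InGeneralPosition.exists_crossing_in_triangle {M : Finset (Fin 2 → ℝ)} (hM : M.card = 29)
    (hgp : InGeneralPosition M) :
    ∃ S ⊆ M, ∃ Q ⊆ M, S.card = 3 ∧ Q.card = 4 ∧ Disjoint S Q ∧
      ∃ x, IsCrossingQuadruple Q x ∧ x ∈ convexHull ℝ (S : Set (Fin 2 → ℝ)) := by
  -- 29 = 4 · 7 + 1, and 7 = d² + d + 1 for d = 2.
  obtain ⟨Q, c, hQM, hQc, hQd⟩ := hgp.exists_disjoint_crossingQuadruples 7 (by omega)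
  let U : Fin 7 → Finset (Fin 2 → ℝ) := fun i => (Finset.univ.erase i).biUnion Q
  have hUM : ∀ i, U i ⊆ M := fun i => Finset.biUnion_subset.2 fun j _ => hQM j
  have hUQ : ∀ i, Disjoint (U i) (Q i) := fun i => by
    rw [Finset.disjoint_biUnion_left]
    exact fun j hj => hQd j i (Finset.ne_of_mem_erase hj)
  by_cases hex : ∃ i, c i ∈ convexHull ℝ (U i : Set (Fin 2 → ℝ))
  · obtain ⟨i, hi⟩ := hex
    rw [convexHull_eq_union] at hi
    simp only [Set.mem_iUnion] at hi
    obtain ⟨t, htU, htind, hct⟩ := hi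
    have htcard : t.card ≤ 3 := by
      have htne : t.Nonempty := by
        rw [← Finset.coe_nonempty, ← convexHull_nonempty_iff (𝕜 := ℝ)]
        exact ⟨_, hct⟩
      have h1 := htind.finrank_vectorSpan_finset_add_one htne
      have h2 := Submodule.finrank_le (vectorSpan ℝ (t : Set (Fin 2 → ℝ)))
      rw [Module.finrank_fin_fun] at h2
      omega
    obtain ⟨S, htS, hSM, hS⟩ := Finset.exists_subsuperset_card_eq (t := M \ Q i) (n := 3)
      (Finset.subset_sdiff.2 ⟨(Finset.coe_subset.1 htU).trans (hUM i),
        (hUQ i).mono_left (Finset.coe_subset.1 htU)⟩) htcard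
      (by rw [Finset.card_sdiff_of_subset (hQM i), (hQc i).card_eq, hM]; norm_num)
    rw [Finset.subset_sdiff] at hSM
    exact ⟨S, hSM.1, Q i, hQM i, hS, (hQc i).card_eq, hSM.2, c i, hQc i,
      convexHull_mono (Finset.coe_subset.2 htS) hct⟩
  · push Not at hex
    -- Otherwise the hull of U i would contain Q i and hence c i. The chosen points are in convex
    -- position, as those with index other than i all lie in U i.
    have hpick : ∀ i, ∃ a ∈ Q i, a ∉ convexHull ℝ (U i : Set (Fin 2 → ℝ)) := fun i => by
      by_contra! hcon
      exact hex i (convexHull_min (fun a ha => hcon a ha) (convex_convexHull ℝ _)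
        (hQc i).mem_convexHull)
    choose a haQ haU using hpick
    have hinj : Function.Injective a := fun i j hij => by
      by_contra hne
      exact Finset.disjoint_left.1 (hQd i j hne) (haQ i) (hij ▸ haQ j)
    obtain ⟨S, hSA, hS, x, hx, hxS⟩ := exists_crossing_in_triangle_of_convex
      (A := Finset.univ.image a) (by rw [Finset.card_image_of_injective _ hinj]; rfl) (by
        intro p hp
        obtain ⟨i, -, rfl⟩ := Finset.mem_image.1 hp
        refine fun h => haU i (convexHull_mono (fun q hq => ?_) h)
        obtain ⟨hqi, hq⟩ := Finset.mem_erase.1 (Finset.mem_coe.1 hq)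
        obtain ⟨j, -, rfl⟩ := Finset.mem_image.1 hq
        exact Finset.mem_coe.2 (Finset.mem_biUnion.2
          ⟨j, by simpa using fun h : j = i => hqi (h ▸ rfl), haQ j⟩))
    have hAM : Finset.univ.image a ⊆ M := Finset.image_subset_iff.2 fun i _ => hQM i (haQ i)
    exact ⟨S, hSA.trans hAM, _, Finset.sdiff_subset.trans hAM, hS, hx.card_eq,
      Finset.disjoint_sdiff, x, hx, hxS⟩

/-- A crossing quadruple of points of `P` determines a crossing pair of segments with the same
endpoints. -/
theorem IsCrossingQuadruple.exists_isCrossingPairIn {P Q : Finset (Fin 2 → ℝ)} {x : Fin 2 → ℝ}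
    {Δ : Set (Fin 2 → ℝ)} (h : IsCrossingQuadruple Q x) (hQ : Q ⊆ P) (hx : x ∈ Δ) :
    ∃ q, IsCrossingPairIn P Δ q ∧ ∀ p, p ∈ Q ↔ ∃ e ∈ q, p ∈ e := by
  obtain ⟨a, b, u, v, hn, rfl, hxab⟩ := h
  simp only [Finset.insert_subset_iff, Finset.singleton_subset_iff] at hQ
  refine ⟨s(s(a, b), s(u, v)), ⟨a, hQ.1, b, hQ.2.1, u, hQ.2.2.1, v, hQ.2.2.2, hn, rfl,
    ⟨x, hxab, hx⟩⟩, fun p => ?_⟩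
  simp [or_assoc]

/-! ### Both parts of the theorem. -/

theorem theorem2 :
    (∀ d : ℕ, 1 ≤ d → ∃ c : ℝ, 0 < c ∧
      ∀ n : ℕ, d ^ 2 + d + 1 ≤ n →
      ∀ P : Finset (Fin d → ℝ), P.card = n → InGeneralPosition P →
        ∃ Δ : Set (Fin d → ℝ), IsSpannedSimplex P d Δ ∧
        ∃ 𝓠 : Finset (Finset (Fin d → ℝ)),
          c * (n.choose (d ^ 2) : ℝ) ≤ (𝓠.card : ℝ) ∧
          ∀ Q ∈ 𝓠, Q ⊆ P ∧ Q.card = d ^ 2 ∧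
            ∃ D : Fin d → Finset (Fin d → ℝ), IsTverbergPartition Q D ∧
              ∃ x : Fin d → ℝ, IsLexMin (hullInter D) x ∧ x ∈ Δ) ∧
    (∃ c : ℝ, 0 < c ∧ ∃ n₀ : ℕ, ∀ n : ℕ, n₀ ≤ n →
      ∀ P : Finset (Fin 2 → ℝ), P.card = n → InGeneralPosition P →
        ∃ Δ : Set (Fin 2 → ℝ), IsSpannedSimplex P 2 Δ ∧
        ∃ 𝓒 : Finset (Sym2 (Sym2 (Fin 2 → ℝ))),
          c * (n : ℝ) ^ 4 ≤ (𝓒.card : ℝ) ∧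
          ∀ q ∈ 𝓒, IsCrossingPairIn P Δ q) := by
  classical
  constructor
  · intro d hd
    set K : ℕ := (d ^ 2 + 1) ^ (d + 1) *
      ((d + 1 + d ^ 2).choose (d + 1) * (d ^ 2 + d + 1).choose (d + 1 + d ^ 2)) with hK
    have hKpos : 0 < K := by
      have h1 : 0 < (d + 1 + d ^ 2).choose (d + 1) := Nat.choose_pos (by omega)
      have h2 : 0 < (d ^ 2 + d + 1).choose (d + 1 + d ^ 2) := Nat.choose_pos (by omega)
      positivity
    refine ⟨(K : ℝ)⁻¹, by positivity, fun n hn P hP _ => ?_⟩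
    obtain ⟨S, hSP, hS, hle⟩ := exists_popular_subset (s := d + 1) (k := d ^ 2)
      (m := d ^ 2 + d + 1) (by omega) hn hP
      (fun S Q => ∃ (D : Fin d → Finset (Fin d → ℝ)) (x : Fin d → ℝ), IsPartition Q D ∧
        hullInter D = {x} ∧ x ∈ convexHull ℝ (S : Set (Fin d → ℝ))) (by
        intro M _ hM
        obtain ⟨S, hSM, hS, D, x, h⟩ := exists_simplex_of_card_eq hd (hM.trans (by omega))
        exact ⟨S, hSM, M \ S, Finset.sdiff_subset, hS,
          by rw [Finset.card_sdiff_of_subset hSM]; omega, Finset.disjoint_sdiff, D, x, h⟩)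
    refine ⟨_, ⟨S, hSP, hS, rfl⟩, (P.powersetCard (d ^ 2)).filter fun Q =>
      ∃ (D : Fin d → Finset (Fin d → ℝ)) (x : Fin d → ℝ), IsPartition Q D ∧
        hullInter D = {x} ∧ x ∈ convexHull ℝ (S : Set (Fin d → ℝ)), ?_, fun Q hQ => ?_⟩
    · rw [inv_mul_le_iff₀ (by positivity)]
      exact_mod_cast hle
    · obtain ⟨hQP, D, x, hD, hDx, hx⟩ := Finset.mem_filter.1 hQ
      rw [Finset.mem_powersetCard] at hQP
      refine ⟨hQP.1, hQP.2, D, ⟨?_, hD, by simp [hDx]⟩, x, ⟨by simp [hDx], ?_⟩, hx⟩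
      · rw [hQP.2]
        obtain ⟨e, rfl⟩ := Nat.exists_eq_add_of_le' hd
        rw [Nat.add_sub_cancel]
        ring
      · intro y hy
        rw [hDx, Set.mem_singleton_iff] at hy
        rw [hy]
  · set K : ℕ := (4 + 1) ^ 3 * ((3 + 4).choose 3 * (29).choose (3 + 4)) with hK
    have hKpos : 0 < K := by
      have h1 : 0 < (3 + 4).choose 3 := Nat.choose_pos (by omega)
      have h2 : 0 < (29).choose (3 + 4) := Nat.choose_pos (by omega)
      positivity
    refine ⟨(384 * K : ℝ)⁻¹, by positivity, 29, fun n hn P hP hgp => ?_⟩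
    obtain ⟨S, hSP, hS, hle⟩ := exists_popular_subset (s := 3) (k := 4) (m := 29)
      (by norm_num) hn hP
      (fun S Q => ∃ x, IsCrossingQuadruple Q x ∧ x ∈ convexHull ℝ (S : Set (Fin 2 → ℝ)))
      fun M hM hMcard => (hgp.mono hM).exists_crossing_in_triangle hMcard
    rw [← hK] at hle
    set 𝓠 := (P.powersetCard 4).filter fun Q => ∃ x, IsCrossingQuadruple Q x ∧
      x ∈ convexHull ℝ (S : Set (Fin 2 → ℝ)) with h𝓠
    have hpair : ∀ Q ∈ 𝓠, ∃ q, IsCrossingPairIn P (convexHull ℝ (S : Set (Fin 2 → ℝ))) q ∧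
        ∀ p, p ∈ Q ↔ ∃ e ∈ q, p ∈ e := by
      intro Q hQ
      obtain ⟨hQP, x, hx, hxS⟩ := Finset.mem_filter.1 hQ
      exact hx.exists_isCrossingPairIn (Finset.mem_powersetCard.1 hQP).1 hxS
    choose! f hf hfmem using hpair
    refine ⟨_, ⟨S, hSP, hS, rfl⟩, 𝓠.image f, ?_, fun q hq => ?_⟩
    -- A crossing pair determines Q as its set of endpoints, so distinct quadruples give distinct
    -- pairs.
    · rw [Finset.card_image_of_injOn fun Q hQ Q' hQ' h => Finset.ext fun p => by
        rw [hfmem Q hQ, hfmem Q' hQ', h]]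
      rw [inv_mul_le_iff₀ (by positivity)]
      -- 384 = 2⁴ · 4!: here n ≤ 2(n − 3), and (n − 3)⁴ ≤ 4! C(n, 4).
      have h1 : (n + 1 - 4) ^ 4 ≤ n.descFactorial 4 := Nat.pow_sub_le_descFactorial n 4
      rw [Nat.descFactorial_eq_factorial_mul_choose] at h1
      have h2 : n ^ 4 ≤ (2 * (n + 1 - 4)) ^ 4 := Nat.pow_le_pow_left (by omega) 4
      have h3 : n ^ 4 ≤ 384 * K * 𝓠.card := by
        calc n ^ 4 ≤ 16 * (n + 1 - 4) ^ 4 := by rw [mul_pow] at h2; exact h2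
          _ ≤ 16 * (24 * n.choose 4) := Nat.mul_le_mul_left _ h1
          _ ≤ 16 * (24 * (K * 𝓠.card)) := by gcongr
          _ = 384 * K * 𝓠.card := by ring
      exact_mod_cast h3
    · obtain ⟨Q, hQ, rfl⟩ := Finset.mem_image.1 hq
      exact hf Q hQ
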